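/- **Setting.** Let $r\ge 0$, $\lambda>0$, $\delta_1,\delta_2>0$ with $\delta_1+\delta_2=1$, and let $c_1,c_2\in\mathbb R$ satisfy $c_1/\delta_1>c_2/\delta_2$. Let $(T_k)_{k\ge1}$ be i.i.d. exponential random variables with parameter $\lambda$, and let $(\sigma_k)_{k\ge1}$ be i.i.d. almost surely nonnegative random variables (the claim sizes), the two sequences being independent. Put $\theta_n=T_1+\cdots+T_n$ and $N(t)=\#\{n\ge1:\theta_n\le t\}$, so that $N$ is a Poisson process with intensity $\lambda$. For initial reserves $u_1,u_2$ and $t\ge0$ set $$U_i(t)=e^{rt}u_i+c_i\int_0^t e^{r(t-v)}\,dv-\delta_i\sum_{k=1}^{N(t)}e^{r(t-\theta_k)}\sigma_k,\qquad i=1,2,$$ $$T_{\max}(u_1,u_2)=\inf\{t\ge0:\max\{U_1(t),U_2(t)\}<0\}\quad(\inf\emptyset=\infty),$$ and for $T>0$ let $\Psi_{\max}(x_1,x_2,T)=P\{T_{\max}(\delta_1x_1,\delta_2x_2)\le T\}$. Let $F_T$ be the distribution of $e^{-rV}\sigma_1$, where $V$ is uniformly distributed on $(0,T]$ and independent of $\sigma_1$,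 and let $\overline{F_T}(x)=1-F_T(x)=P\{e^{-rV}\sigma_1>x\}$. **Theorem 3.1.** Suppose that $P\{\sigma_1>x\}=L(x)/x^{\alpha}$ for all $x>0$, where $\alpha>0$ and $L$ is continuous on $(0,\infty)$ and slowly varying (that is, $L(tx)/L(x)\to1$ as $x\to\infty$ for every $t>0$), with $\lim_{x\to\infty}L(x)=\infty$. Then for every $T>0$, $$\lim_{x_2\ge x_1\to\infty}\frac{\Psi_{\max}(x_1,x_2,T)}{\lambda T\,\overline{F_T}(x_2)}=1,$$ that is, for every $\varepsilon>0$ there is an $M$ such that the quotient differs from $1$ by less than $\varepsilon$ whenever $x_2\ge x_1\ge M$. -/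

import Mathlib

open MeasureTheory ProbabilityTheory Filter Topology

namespace BivariateRisk

noncomputable section

/-- `L` is slowly varying at infinity. -/
def SlowlyVarying (L : ℝ → ℝ) : Prop :=
  ∀ t : ℝ, 0 < t → Tendsto (fun x => L (t * x) / L x) atTop (𝓝 1)

variable {Ω : Type*}

/-- The arrival time `θ_n = T_1 + ⋯ + T_n` of the `n`-th claim (`θ_0 = 0`), where `τ i` is the
inter-arrival time between the `i`-th and the `(i+1)`-st claim. -/
def arrivalTime (τ : ℕ → Ω → ℝ) (n : ℕ) (ω : Ω) : ℝ :=
  ∑ i ∈ Finset.range n, τ i ω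

/-- The number `N(t) = #{n ≥ 1 : θ_n ≤ t}` of claims up to time `t`. It is a Poisson process of
intensity `lam` when the `τ i` are i.i.d. exponential with parameter `lam`. -/
def claimCount (τ : ℕ → Ω → ℝ) (t : ℝ) (ω : Ω) : ℕ :=
  {k : ℕ | arrivalTime τ (k + 1) ω ≤ t}.ncard

/-- The surplus process with constant interest rate `r`,
`U(t) = e^{rt} u + c ∫_0^t e^{r(t-v)} dv - δ ∑_{k=1}^{N(t)} e^{r(t-θ_k)} σ_k`;
the size of the `(k+1)`-st claim is `σ k`. -/
def surplus (r : ℝ) (τ σ : ℕ → Ω → ℝ) (u c δ t : ℝ) (ω : Ω) : ℝ :=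
  Real.exp (r * t) * u + c * (∫ v in (0 : ℝ)..t, Real.exp (r * (t - v)))
    - δ * ∑ k ∈ Finset.range (claimCount τ t ω),
        Real.exp (r * (t - arrivalTime τ (k + 1) ω)) * σ k ω

/-- `T_max(u₁, u₂) = inf {t ≥ 0 | max (U₁(t), U₂(t)) < 0}`, with `inf ∅ = ∞`. -/
def ruinTimeMax (r : ℝ) (τ σ : ℕ → Ω → ℝ) (c₁ c₂ δ₁ δ₂ u₁ u₂ : ℝ) (ω : Ω) : EReal :=
  sInf {s : EReal | ∃ t : ℝ, 0 ≤ t ∧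
    max (surplus r τ σ u₁ c₁ δ₁ t ω) (surplus r τ σ u₂ c₂ δ₂ t ω) < 0 ∧ s = (t : EReal)}

/-- The finite time ruin probability `Ψ_max(x₁, x₂, T) = P{T_max(δ₁ x₁, δ₂ x₂) ≤ T}`. -/
def ruinProbMax [MeasurableSpace Ω] (μ : Measure Ω) (r : ℝ) (τ σ : ℕ → Ω → ℝ)
    (c₁ c₂ δ₁ δ₂ x₁ x₂ T : ℝ) : ℝ :=
  μ.real {ω | ruinTimeMax r τ σ c₁ c₂ δ₁ δ₂ (δ₁ * x₁) (δ₂ * x₂) ω ≤ (T : EReal)}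

/-- The law `F_T` of `e^{-rV} σ`, where `V` is uniformly distributed on `(0, T]`, `σ` has law `F`,
and `V` and `σ` are independent. -/
def discountedClaimLaw (F : Measure ℝ) (r T : ℝ) : Measure ℝ :=
  ((volume[|Set.Ioc (0 : ℝ) T]).prod F).map (fun p : ℝ × ℝ => Real.exp (-r * p.1) * p.2)

/-- The tail `x ↦ G(x, ∞)` of a law `G` on the line. -/
def tail (G : Measure ℝ) (x : ℝ) : ℝ := G.real (Set.Ioi x)

end

end BivariateRisk

/-! Let `D(t)` denote the discounted aggregate claims up to time `t`. Dividing the surplus of line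
`i` by `e^{rt} δ_i` shows that it is negative iff `D(t)` exceeds `x_i` plus a premium term bounded
on bounded time intervals. As `D` is nondecreasing and `x₁ ≤ x₂`, simultaneous ruin by `T` is
squeezed between `D(T) > x₂ + C` and, almost surely, `D(T) > x₂ - C'` (`ruinTimeMax_le`,
`RegularPath.lt_discountedClaims_of_ruinTimeMax_le`). A regularly varying tail ignores constant
shifts, so it remains to find the tail of `D(T)`.

This is the principle of a single big jump (`ClaimModel.tendsto_discountedClaims_ratio`): `P(D(T) >
x)` is asymptotic to the sum over `k` of the probabilities that the `k`-th discounted claim exceeds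
`x`. Two large claims cost the square of the tail, which is negligible. Many arrivals are negligible
uniformly in `x`, since the Potter-type bound on `tail F (x / m)` grows only geometrically in `m`
while the probability of `m` arrivals decays factorially. The Erlang laws of the arrival times sum
to `λ dv` on `(0, T]`, which gives the constant `c = λ ∫ e^{-αrv} dv` over that interval. The
denominator `λ T tail F_T` is the same average of `tail F (e^{rv} x)`, hence also asymptotic to `c *
tail F x`. -/

namespace BivariateRisk

/-! ### Erlang arrival times and the Poisson renewal measure. -/

open scoped ENNReal Nat

/-- The density of the Erlang law with shape `n + 1`. -/
lemma gammaPDF_natCast_succ (n : ℕ) (lam x : ℝ) :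
    gammaPDF (n + 1 : ℝ) lam x = (Set.Ici (0 : ℝ)).indicator
      (fun y => ENNReal.ofReal (lam ^ (n + 1) / n ! * y ^ n * Real.exp (-(lam * y)))) x := by
  by_cases hx : 0 ≤ x
  · rw [Set.indicator_of_mem (Set.mem_Ici.2 hx), gammaPDF_of_nonneg hx, Real.Gamma_nat_eq_factorial,
      add_sub_cancel_right, Real.rpow_natCast, ← Nat.cast_succ, Real.rpow_natCast]
  · rw [Set.indicator_of_notMem (by simpa using hx), gammaPDF_of_neg (not_le.1 hx)]

lemma measurable_gammaPDF (a lam : ℝ) : Measurable (gammaPDF a lam) :=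
  (measurable_gammaPDFReal a lam).ennreal_ofReal

/-- Convolving the Erlang density of shape `n + 1` with an exponential density. -/
lemma lconvolution_gammaPDF_one (n : ℕ) {lam : ℝ} (hlam : 0 < lam) (x : ℝ) :
    (gammaPDF (n + 1 : ℝ) lam ⋆ₗ gammaPDF 1 lam) x = gammaPDF ((n + 1 : ℕ) + 1 : ℝ) lam x := by
  rw [lconvolution_def, gammaPDF_natCast_succ]
  have h1 : ∀ z, gammaPDF 1 lam z = (Set.Ici (0 : ℝ)).indicator
      (fun y => ENNReal.ofReal (lam * Real.exp (-(lam * y)))) z := by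
    intro z
    have := gammaPDF_natCast_succ 0 lam z
    simpa using this
  -- The two exponentials merge into one independent of `y`, so only `y ^ n` remains to be
  -- integrated over `[0, x]`.
  have h2 : ∀ y, gammaPDF (n + 1 : ℝ) lam y * gammaPDF 1 lam (-y + x) =
      (Set.Icc 0 x).indicator (fun y => ENNReal.ofReal
        (lam ^ (n + 2) / n ! * Real.exp (-(lam * x)) * y ^ n)) y := by
    intro y
    rw [gammaPDF_natCast_succ, h1]
    by_cases hy : y ∈ Set.Icc 0 x
    · have hy0 : 0 ≤ y := hy.1
      rw [Set.indicator_of_mem hy, Set.indicator_of_mem (Set.mem_Ici.2 hy.1),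
        Set.indicator_of_mem (by simpa using hy.2), ← ENNReal.ofReal_mul (by positivity)]
      congr 1
      have : Real.exp (-(lam * x)) = Real.exp (-(lam * y)) * Real.exp (-(lam * (-y + x))) := by
        rw [← Real.exp_add]; congr 1; ring
      rw [this]; ring
    · rw [Set.indicator_of_notMem hy]
      by_cases hy0 : 0 ≤ y
      · have : ¬ y ≤ x := fun h => hy ⟨hy0, h⟩
        rw [Set.indicator_of_notMem (a := -y + x) (by simpa using this), mul_zero]
      · rw [Set.indicator_of_notMem (a := y) (by simpa using hy0), zero_mul]
  simp_rw [h2]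
  rw [lintegral_indicator measurableSet_Icc]
  by_cases hx : 0 ≤ x
  · rw [Set.indicator_of_mem (Set.mem_Ici.2 hx), ← ofReal_integral_eq_lintegral_ofReal]
    · congr 1
      rw [integral_Icc_eq_integral_Ioc, ← intervalIntegral.integral_of_le hx,
        intervalIntegral.integral_const_mul, integral_pow, Nat.factorial_succ]
      push_cast
      field_simp
      ring
    · exact (Continuous.integrableOn_Icc (by fun_prop))
    · refine (ae_restrict_iff' measurableSet_Icc).2 (ae_of_all _ fun y hy => ?_)
      have := hy.1
      simp only [Pi.zero_apply]
      positivity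
  · rw [Set.Icc_eq_empty hx, Set.indicator_of_notMem (by simpa using hx)]
    simp

lemma gammaMeasure_conv_expMeasure (n : ℕ) {lam : ℝ} (hlam : 0 < lam) :
    gammaMeasure (n + 1 : ℝ) lam ∗ expMeasure lam = gammaMeasure ((n + 1 : ℕ) + 1 : ℝ) lam := by
  have := isProbabilityMeasure_gammaMeasure (a := n + 1) (by positivity) hlam
  have := isProbabilityMeasure_expMeasure hlam
  rw [expMeasure, gammaMeasure, gammaMeasure, conv_withDensity_eq_lconvolution
    (measurable_gammaPDF _ _) (measurable_gammaPDF _ _), gammaMeasure]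
  congr 1
  ext x
  exact lconvolution_gammaPDF_one n hlam x

variable {Ω : Type*} [MeasurableSpace Ω] {μ : Measure Ω}

lemma hasLaw_arrivalTime {lam : ℝ} (hlam : 0 < lam) {τ : ℕ → Ω → ℝ}
    (hτ : ∀ k, HasLaw (τ k) (expMeasure lam) μ) (hτi : iIndepFun τ μ) (n : ℕ) :
    HasLaw (arrivalTime τ (n + 1)) (gammaMeasure (n + 1 : ℝ) lam) μ := by
  induction n with
  | zero =>
    have : arrivalTime τ 1 = τ 0 := by ext ω; simp [arrivalTime]
    simpa [this, expMeasure] using hτ 0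
  | succ n ih =>
    have := isProbabilityMeasure_gammaMeasure (a := n + 1) (by positivity) hlam
    have := isProbabilityMeasure_expMeasure hlam
    have hs : arrivalTime τ (n + 1) = ∑ j ∈ Finset.range (n + 1), τ j := by
      ext ω; simp [arrivalTime]
    have hi : IndepFun (arrivalTime τ (n + 1)) (τ (n + 1)) μ := by
      rw [hs]
      exact hτi.indepFun_finsetSum_of_notMem₀ (fun i => (hτ i).aemeasurable) (by simp)
    have := hi.hasLaw_add ih (hτ (n + 1))
    rw [gammaMeasure_conv_expMeasure n hlam] at this
    convert this using 1
    ext ω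
    simp [arrivalTime, Finset.sum_range_succ _ (n + 1)]

lemma gammaMeasure_ae_nonneg (a lam : ℝ) : ∀ᵐ v ∂gammaMeasure a lam, 0 ≤ v := by
  rw [gammaMeasure, ae_withDensity_iff (measurable_gammaPDF _ _)]
  refine ae_of_all _ fun v hv => ?_
  by_contra h
  exact hv (gammaPDF_of_neg (not_le.1 h))

/-- Bounding the density by its polynomial factor at `T` is crude, but keeps the factorial decay
needed for Borel–Cantelli and for beating the Potter constants. -/
lemma gammaMeasure_Iic_le (n : ℕ) {lam T : ℝ} (hlam : 0 < lam) (hT : 0 < T) :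
    gammaMeasure (n + 1 : ℝ) lam (Set.Iic T) ≤ ENNReal.ofReal ((lam * T) ^ (n + 1) / n !) := by
  rw [gammaMeasure, withDensity_apply _ measurableSet_Iic]
  simp_rw [gammaPDF_natCast_succ]
  rw [lintegral_indicator measurableSet_Ici, Measure.restrict_restrict measurableSet_Ici,
    Set.Ici_inter_Iic]
  calc _ ≤ ∫⁻ _ in Set.Icc 0 T, ENNReal.ofReal (lam ^ (n + 1) / n ! * T ^ n) := by
        refine setLIntegral_mono' measurableSet_Icc fun y hy => ENNReal.ofReal_le_ofReal ?_
        have hy0 := hy.1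
        have h1 : Real.exp (-(lam * y)) ≤ 1 := Real.exp_le_one_iff.2 (by nlinarith)
        have h2 : y ^ n ≤ T ^ n := pow_le_pow_left₀ hy.1 hy.2 n
        calc lam ^ (n + 1) / n ! * y ^ n * Real.exp (-(lam * y))
            ≤ lam ^ (n + 1) / n ! * y ^ n * 1 := by gcongr
          _ ≤ lam ^ (n + 1) / n ! * T ^ n := by rw [mul_one]; gcongr
    _ = _ := by
        rw [setLIntegral_const, Real.volume_Icc, sub_zero, ← ENNReal.ofReal_mul (by positivity)]
        congr 1
        ring

/-- The renewal measure of the Poisson process is a multiple of Lebesgue measure. -/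
lemma sum_gammaMeasure_restrict {lam : ℝ} (hlam : 0 < lam) (T : ℝ) :
    Measure.sum (fun n : ℕ => (gammaMeasure (n + 1 : ℝ) lam).restrict (Set.Iic T)) =
      ENNReal.ofReal lam • volume.restrict (Set.Ioc 0 T) := by
  -- The Erlang densities are `λ` times Poisson weights, which sum to one.
  have h : ∀ x, (∑' n : ℕ, gammaPDF (n + 1 : ℝ) lam x) =
      (Set.Ici (0 : ℝ)).indicator (fun _ => ENNReal.ofReal lam) x := by
    intro x
    simp_rw [gammaPDF_natCast_succ]
    by_cases hx : 0 ≤ x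
    · simp_rw [Set.indicator_of_mem (Set.mem_Ici.2 hx)]
      have hs : HasSum (fun n : ℕ => lam ^ (n + 1) / n ! * x ^ n * Real.exp (-(lam * x))) lam := by
        have h0 := (NormedSpace.expSeries_div_hasSum_exp (lam * x)).mul_left
          (lam * Real.exp (-(lam * x)))
        rw [← Real.exp_eq_exp_ℝ, mul_assoc, ← Real.exp_add] at h0
        simp only [neg_add_cancel, Real.exp_zero, mul_one] at h0
        refine h0.congr_fun fun n => ?_
        rw [mul_pow]; ring
      rw [← ENNReal.ofReal_tsum_of_nonneg (fun n => by positivity) hs.summable, hs.tsum_eq]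
    · simp [Set.indicator_of_notMem (show x ∉ Set.Ici (0 : ℝ) by simpa using hx)]
  rw [← Measure.restrict_sum _ measurableSet_Iic]
  have h3 : Measure.sum (fun n : ℕ => gammaMeasure (n + 1 : ℝ) lam) =
      ENNReal.ofReal lam • volume.restrict (Set.Ioi 0) := by
    simp only [gammaMeasure]
    rw [← withDensity_tsum (fun n => measurable_gammaPDF _ _)]
    have : (∑' n : ℕ, gammaPDF (n + 1 : ℝ) lam) =
        (Set.Ici (0 : ℝ)).indicator (fun _ => ENNReal.ofReal lam) := by
      ext x
      rw [← h x, ENNReal.tsum_apply]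
    rw [this, withDensity_indicator measurableSet_Ici, withDensity_const,
      restrict_Ioi_eq_restrict_Ici]
  rw [h3, Measure.restrict_smul, Measure.restrict_restrict measurableSet_Iic, Set.inter_comm,
    Set.Ioi_inter_Iic]

end BivariateRisk

namespace BivariateRisk

/-! ### Regularly varying tails. -/

section Tail

lemma tendsto_tail_ratio_of_slowlyVarying {F : Measure ℝ} {α : ℝ} {L : ℝ → ℝ} (hLs : SlowlyVarying L)
    (htail : ∀ x : ℝ, 0 < x → tail F x = L x / x ^ α) {t : ℝ} (ht : 0 < t) :
    Tendsto (fun x => tail F (t * x) / tail F x) atTop (𝓝 (t ^ (-α))) := by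
  have h := (hLs t ht).mul_const (t ^ (-α))
  rw [one_mul] at h
  refine h.congr' ?_
  filter_upwards [eventually_gt_atTop 0] with x hx
  rw [htail x hx, htail _ (mul_pos ht hx), Real.mul_rpow ht.le hx.le, Real.rpow_neg ht.le]
  have h1 : x ^ α ≠ 0 := (Real.rpow_pos_of_pos hx α).ne'
  have h2 : t ^ α ≠ 0 := (Real.rpow_pos_of_pos ht α).ne'
  -- If `L x = 0`, both quotients vanish because division by zero gives zero.
  by_cases hL : L x = 0
  · simp [hL]
  · field_simp

variable {F : Measure ℝ} [IsProbabilityMeasure F] {α : ℝ}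

lemma tail_nonneg (F : Measure ℝ) (x : ℝ) : 0 ≤ tail F x := measureReal_nonneg

lemma tail_le_one (x : ℝ) : tail F x ≤ 1 := measureReal_le_one

lemma antitone_tail : Antitone (tail F) := fun _ _ h => measureReal_mono (Set.Ioi_subset_Ioi h)

lemma measurable_tail : Measurable (tail F) := antitone_tail.measurable

lemma tail_eq_one_sub_cdf (x : ℝ) : tail F x = 1 - cdf F x := by
  rw [tail, cdf_eq_real, ← Set.compl_Iic, probReal_compl_eq_one_sub measurableSet_Iic]

lemma tendsto_tail_atTop : Tendsto (tail F) atTop (𝓝 0) := by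
  have h := (tendsto_cdf_atTop F).const_sub 1
  simp only [sub_self] at h
  exact h.congr fun x => (tail_eq_one_sub_cdf x).symm

/-- The tail is antitone, so positivity at some larger point, where `L` is positive, suffices. -/
lemma tail_pos_of_eq_div {L : ℝ → ℝ} (hLt : Tendsto L atTop atTop)
    (htail : ∀ x : ℝ, 0 < x → tail F x = L x / x ^ α) (x : ℝ) : 0 < tail F x := by
  obtain ⟨y, hyx, hy0, hLy⟩ := ((eventually_ge_atTop x).and
    ((eventually_gt_atTop 0).and (hLt.eventually_gt_atTop 0))).exists
  refine lt_of_lt_of_le ?_ (antitone_tail hyx)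
  rw [htail y hy0]
  positivity

/-- A positive tail that varies regularly with index `-α`. -/
structure RegularTail (F : Measure ℝ) (α : ℝ) : Prop where
  pos : ∀ x, 0 < tail F x
  ratio : ∀ t : ℝ, 0 < t → Tendsto (fun x => tail F (t * x) / tail F x) atTop (𝓝 (t ^ (-α)))

namespace RegularTail

/-- A regularly varying tail is long-tailed. -/
lemma tendsto_shift (h : RegularTail F α) (C : ℝ) :
    Tendsto (fun x => tail F (x + C) / tail F x) atTop (𝓝 1) := by
  have hcont : Tendsto (fun t : ℝ => t ^ (-α)) (𝓝 1) (𝓝 1) := by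
    have := (Real.continuousAt_rpow_const 1 (-α) (Or.inl one_ne_zero)).tendsto
    simpa using this
  -- A factor absorbs a shift: eventually `x + C ≤ t * x` if `t > 1`, and `t * x ≤ x + C` if `0 < t
  -- < 1`; then let `t` be close to 1.
  refine tendsto_order.2 ⟨fun a ha => ?_, fun a ha => ?_⟩
  · obtain ⟨t, hta, ht1⟩ := (((hcont.mono_left nhdsWithin_le_nhds).eventually
      (lt_mem_nhds ha)).and (self_mem_nhdsWithin (s := Set.Ioi (1 : ℝ)))).exists
    replace ht1 : 1 < t := ht1
    filter_upwards [(h.ratio t (by linarith)).eventually (lt_mem_nhds hta),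
      eventually_ge_atTop (C / (t - 1))] with x hx hxC
    refine hx.trans_le (div_le_div_of_nonneg_right (antitone_tail ?_) (h.pos x).le)
    have := (div_le_iff₀ (by linarith)).1 hxC
    linarith
  · obtain ⟨t, hta, ht1, ht0⟩ := (((hcont.mono_left nhdsWithin_le_nhds).eventually
      (gt_mem_nhds ha)).and ((eventually_mem_nhdsWithin (a := (1 : ℝ)) (s := Set.Iio 1)).and
      ((tendsto_id.mono_left nhdsWithin_le_nhds).eventually (lt_mem_nhds zero_lt_one)))).exists
    replace ht1 : t < 1 := ht1
    filter_upwards [(h.ratio t ht0).eventually (gt_mem_nhds hta),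
      eventually_ge_atTop (-C / (1 - t))] with x hx hxC
    refine lt_of_le_of_lt (div_le_div_of_nonneg_right (antitone_tail ?_) (h.pos x).le) hx
    have := (div_le_iff₀ (by linarith)).1 hxC
    linarith

/-- The square of a rescaled regularly varying tail is negligible against the tail. -/
lemma tendsto_sq_div (h : RegularTail F α) {t : ℝ} (ht : 0 < t) :
    Tendsto (fun x => tail F (t * x) ^ 2 / tail F x) atTop (𝓝 0) := by
  have h1 := (h.ratio t ht).mul (tendsto_tail_atTop (F := F).comp (tendsto_id.const_mul_atTop ht))
  rw [mul_zero] at h1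
  refine h1.congr fun x => ?_
  simp only [Function.comp, id]
  ring

/-- A bound of Potter type. -/
lemma exists_div_two_pow_le (h : RegularTail F α) :
    ∃ C K x₀ : ℝ, 0 < C ∧ 0 < K ∧
      ∀ (j : ℕ) (x : ℝ), x₀ ≤ x → tail F (x / 2 ^ j) ≤ C * K ^ j * tail F x := by
  have h2 := h.ratio (1 / 2) (by norm_num)
  obtain ⟨K, hK⟩ : ∃ K : ℝ, max 1 ((1 / 2 : ℝ) ^ (-α)) < K := exists_gt _
  have hK1 : 1 < K := (le_max_left _ _).trans_lt hK
  obtain ⟨x₀, hx₀⟩ := eventually_atTop.1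
    (h2.eventually (gt_mem_nhds ((le_max_right _ _).trans_lt hK)))
  -- Each halving above `x₀` costs a factor `K`. Once the level drops below `x₀`, the trivial bound
  -- 1 is paid for by the constant `(tail F x₀)⁻¹`.
  have hstep : ∀ x, x₀ ≤ x → tail F (x / 2) ≤ K * tail F x := by
    intro x hx
    have := (div_lt_iff₀ (h.pos x)).1 (hx₀ x hx)
    rw [show x / 2 = 1 / 2 * x by ring]
    exact this.le
  have hC : 1 ≤ (tail F x₀)⁻¹ := (one_le_inv₀ (h.pos x₀)).2 (tail_le_one x₀)
  refine ⟨(tail F x₀)⁻¹, K, x₀, by linarith, by linarith, fun j => ?_⟩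
  induction j with
  | zero =>
    intro x _
    have := tail_nonneg F x
    simp only [pow_zero, div_one, mul_one]
    nlinarith
  | succ j ih =>
    intro x hx
    have hC0 : 0 ≤ (tail F x₀)⁻¹ := by linarith
    by_cases hx2 : x₀ ≤ x / 2
    · calc tail F (x / 2 ^ (j + 1)) = tail F (x / 2 / 2 ^ j) := by rw [pow_succ', div_div]
        _ ≤ (tail F x₀)⁻¹ * K ^ j * tail F (x / 2) := ih _ hx2
        _ ≤ (tail F x₀)⁻¹ * K ^ j * (K * tail F x) := by gcongr; exact hstep x hx
        _ = _ := by ring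
    · have h3 : tail F x₀ ≤ K * tail F x :=
        (antitone_tail (not_le.1 hx2).le).trans (hstep x hx)
      have h4 : 1 ≤ K ^ j := one_le_pow₀ hK1.le
      calc tail F (x / 2 ^ (j + 1)) ≤ 1 := tail_le_one _
        _ = (tail F x₀)⁻¹ * 1 * tail F x₀ := by
            rw [mul_one, inv_mul_cancel₀ (h.pos x₀).ne']
        _ ≤ (tail F x₀)⁻¹ * K ^ j * (K * tail F x) := by
            have := tail_nonneg F x₀
            gcongr
        _ = _ := by ring

/-- Replacing `m` by `2 ^ m` is wasteful, but geometric growth in `m` is harmless against a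
factorial. -/
lemma exists_div_natCast_le (h : RegularTail F α) :
    ∃ C K x₀ : ℝ, 0 < C ∧ 0 < K ∧
      ∀ (m : ℕ) (x : ℝ), 0 < m → x₀ ≤ x → tail F (x / m) ≤ C * K ^ m * tail F x := by
  obtain ⟨C, K, x₀, hC, hK, hb⟩ := h.exists_div_two_pow_le
  refine ⟨C, K, max x₀ 0, hC, hK, fun m x hm hx => ?_⟩
  refine (antitone_tail ?_).trans (hb m x ((le_max_left _ _).trans hx))
  have hx0 : 0 ≤ x := (le_max_right _ _).trans hx
  have hm' : (0 : ℝ) < m := by exact_mod_cast hm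
  have : (m : ℝ) ≤ 2 ^ m := by exact_mod_cast Nat.lt_two_pow_self.le
  gcongr

/-- Averaging the tail over a discount factor. -/
lemma tendsto_integral_discounted (h : RegularTail F α) {r : ℝ} (hr : 0 ≤ r) (ν : Measure ℝ)
    [IsFiniteMeasure ν] (hν : ∀ᵐ v ∂ν, 0 ≤ v) :
    Tendsto (fun x => (∫ v, tail F (Real.exp (r * v) * x) ∂ν) / tail F x) atTop
      (𝓝 (∫ v, Real.exp (r * v) ^ (-α) ∂ν)) := by
  -- Dominated convergence: for `v, x ≥ 0` the level `e^{rv} x` is at least `x`, so the ratio is at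
  -- most 1.
  simp_rw [← integral_div]
  refine tendsto_integral_filter_of_dominated_convergence (fun _ => 1) ?_ ?_
    (integrable_const _) ?_
  · refine Eventually.of_forall fun x => Measurable.aestronglyMeasurable ?_
    exact (measurable_tail.comp (by fun_prop)).div_const _
  · filter_upwards [eventually_ge_atTop 0] with x hx
    filter_upwards [hν] with v hv
    rw [Real.norm_of_nonneg (div_nonneg (tail_nonneg _ _) (tail_nonneg _ _)),
      div_le_one (h.pos x)]
    exact antitone_tail (le_mul_of_one_le_left hx (Real.one_le_exp (mul_nonneg hr hv)))
  · exact ae_of_all _ fun v => h.ratio _ (Real.exp_pos _)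

end RegularTail

/-- Fubini in the uniform time; the factor `T` cancels its density, leaving Lebesgue measure, to be
matched with the renewal measure. -/
lemma mul_tail_discountedClaimLaw (r : ℝ) {T : ℝ} (hT : 0 < T) (x : ℝ) :
    T * tail (discountedClaimLaw F r T) x =
      ∫ v in Set.Ioc 0 T, tail F (Real.exp (r * v) * x) := by
  have hm : Measurable (fun p : ℝ × ℝ => Real.exp (-r * p.1) * p.2) := by fun_prop
  have hms : MeasurableSet ((fun p : ℝ × ℝ => Real.exp (-r * p.1) * p.2) ⁻¹' Set.Ioi x) :=
    hm measurableSet_Ioi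
  rw [tail, discountedClaimLaw, map_measureReal_apply hm measurableSet_Ioi, measureReal_def,
    Measure.prod_apply hms]
  have hsec : ∀ v : ℝ, F (Prod.mk v ⁻¹' ((fun p : ℝ × ℝ => Real.exp (-r * p.1) * p.2) ⁻¹'
      Set.Ioi x)) = ENNReal.ofReal (tail F (Real.exp (r * v) * x)) := by
    intro v
    rw [tail, ofReal_measureReal]
    congr 1
    ext y
    simp only [Set.mem_preimage, Set.mem_Ioi]
    rw [neg_mul, Real.exp_neg, inv_mul_eq_div, lt_div_iff₀' (Real.exp_pos _)]
  simp_rw [hsec]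
  rw [← integral_eq_lintegral_of_nonneg_ae (ae_of_all _ fun v => tail_nonneg _ _)
    (measurable_tail.comp (by fun_prop)).aestronglyMeasurable, ProbabilityTheory.cond, integral_smul_measure,
    Real.volume_Ioc, sub_zero, ENNReal.toReal_inv, ENNReal.toReal_ofReal hT.le, smul_eq_mul,
    mul_inv_cancel_left₀ hT.ne']

end Tail

end BivariateRisk

namespace BivariateRisk

/-! ### Pathwise comparison of ruin with large discounted claims. -/

section Paths

variable {Ω : Type*}

/-- The discounted aggregate claims `∑_{k ≤ N(t)} e^{-r θ_k} σ_k`. -/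
noncomputable def discountedClaims (r : ℝ) (τ σ : ℕ → Ω → ℝ) (t : ℝ) (ω : Ω) : ℝ :=
  ∑ k ∈ Finset.range (claimCount τ t ω), Real.exp (-(r * arrivalTime τ (k + 1) ω)) * σ k ω

/-- The discounted value of the `k`-th claim if it arrives before time `t`, and zero otherwise. -/
noncomputable def discountedClaim (r : ℝ) (τ σ : ℕ → Ω → ℝ) (t : ℝ) (k : ℕ) (ω : Ω) : ℝ :=
  if arrivalTime τ (k + 1) ω ≤ t then Real.exp (-(r * arrivalTime τ (k + 1) ω)) * σ k ω else 0

/-- Factoring out `e^{rt} > 0` leaves a random part that depends on `t` only through the number of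
claims. -/
lemma surplus_neg_iff (r : ℝ) (τ σ : ℕ → Ω → ℝ) (u c δ t : ℝ) (ω : Ω) :
    surplus r τ σ u c δ t ω < 0 ↔
      u + c * (∫ v in (0 : ℝ)..t, Real.exp (-(r * v))) < δ * discountedClaims r τ σ t ω := by
  have h1 : (∫ v in (0 : ℝ)..t, Real.exp (r * (t - v))) =
      Real.exp (r * t) * ∫ v in (0 : ℝ)..t, Real.exp (-(r * v)) := by
    rw [← intervalIntegral.integral_const_mul]
    congr 1
    ext v
    rw [← Real.exp_add]
    ring_nf
  have h2 : ∑ k ∈ Finset.range (claimCount τ t ω),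
        Real.exp (r * (t - arrivalTime τ (k + 1) ω)) * σ k ω =
      Real.exp (r * t) * discountedClaims r τ σ t ω := by
    rw [discountedClaims, Finset.mul_sum]
    refine Finset.sum_congr rfl fun k _ => ?_
    rw [← mul_assoc, ← Real.exp_add]
    ring_nf
  have h3 : surplus r τ σ u c δ t ω = Real.exp (r * t) *
      (u + c * (∫ v in (0 : ℝ)..t, Real.exp (-(r * v))) - δ * discountedClaims r τ σ t ω) := by
    rw [surplus, h1, h2]
    ring
  rw [h3, ← sub_neg (b := δ * _)]
  exact ⟨fun h => (pos_iff_neg_of_mul_neg h).1 (Real.exp_pos _),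
    mul_neg_of_pos_of_neg (Real.exp_pos _)⟩

lemma abs_mul_integral_exp_le {r t : ℝ} (hr : 0 ≤ r) (ht : 0 ≤ t) (c : ℝ) :
    |c * ∫ v in (0 : ℝ)..t, Real.exp (-(r * v))| ≤ |c| * t := by
  rw [abs_mul]
  refine mul_le_mul_of_nonneg_left ?_ (abs_nonneg c)
  have := intervalIntegral.norm_integral_le_of_norm_le_const (a := 0) (b := t) (C := 1)
    (f := fun v => Real.exp (-(r * v))) fun v hv => by
      rw [Set.uIoc_of_le ht] at hv
      rw [Real.norm_of_nonneg (Real.exp_pos _).le]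
      exact Real.exp_le_one_iff.2 (neg_nonpos.2 (mul_nonneg hr hv.1.le))
  simpa [abs_of_nonneg ht] using this

/-- Both lines are negative at time `T` itself: the discounted premiums amount to at most `|c_i| T`,
and a level above `x₂` is also above `x₁`. -/
lemma ruinTimeMax_le {τ σ : ℕ → Ω → ℝ} {ω : Ω} {r T : ℝ} (hr : 0 ≤ r) (hT : 0 ≤ T)
    {c₁ c₂ δ₁ δ₂ x₁ x₂ : ℝ} (hδ₁ : 0 < δ₁) (hδ₂ : 0 < δ₂) (hx : x₁ ≤ x₂)
    (hS : x₂ + (|c₁| / δ₁ + |c₂| / δ₂) * T < discountedClaims r τ σ T ω) :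
    ruinTimeMax r τ σ c₁ c₂ δ₁ δ₂ (δ₁ * x₁) (δ₂ * x₂) ω ≤ (T : EReal) := by
  refine sInf_le ⟨T, hT, ?_, rfl⟩
  have key : ∀ c δ x d : ℝ, 0 < δ → 0 ≤ d → x ≤ x₂ → |c| / δ ≤ d →
      x₂ + d * T < discountedClaims r τ σ T ω → surplus r τ σ (δ * x) c δ T ω < 0 := by
    intro c δ x d hδ hd hx hcd hlt
    refine (surplus_neg_iff r τ σ (δ * x) c δ T ω).2 ?_
    have h1 := abs_mul_integral_exp_le hr hT c
    have h2 : |c| * T ≤ δ * (d * T) := by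
      rw [← mul_assoc]
      exact mul_le_mul_of_nonneg_right ((div_le_iff₀' hδ).1 hcd) hT
    have h3 := mul_lt_mul_of_pos_left hlt hδ
    have h4 := mul_le_mul_of_nonneg_left hx hδ.le
    have h5 := (abs_le.1 h1).2
    linarith
  have hd₁ : 0 ≤ |c₁| / δ₁ := by positivity
  have hd₂ : 0 ≤ |c₂| / δ₂ := by positivity
  exact max_lt (key c₁ δ₁ x₁ _ hδ₁ (by positivity) hx (by linarith) hS)
    (key c₂ δ₂ x₂ _ hδ₂ (by positivity) le_rfl (by linarith) hS)

/-- Nonnegative waiting times and claims, with finitely many claims in bounded time. -/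
structure RegularPath (τ σ : ℕ → Ω → ℝ) (ω : Ω) : Prop where
  waiting_nonneg : ∀ k, 0 ≤ τ k ω
  claim_nonneg : ∀ k, 0 ≤ σ k ω
  finite : ∀ t, {k : ℕ | arrivalTime τ (k + 1) ω ≤ t}.Finite

namespace RegularPath

variable {τ σ : ℕ → Ω → ℝ} {ω : Ω}

lemma arrivalTime_nonneg (h : RegularPath τ σ ω) (n : ℕ) : 0 ≤ arrivalTime τ n ω :=
  Finset.sum_nonneg fun i _ => h.waiting_nonneg i

lemma monotone_arrivalTime (h : RegularPath τ σ ω) : Monotone fun n => arrivalTime τ n ω :=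
  monotone_nat_of_le_succ fun n => by
    simpa [arrivalTime, Finset.sum_range_succ] using h.waiting_nonneg n

/-- Monotone arrival times make the claims up to `t` an initial segment. Finiteness matters because
`ncard` of an infinite set is 0. -/
lemma lt_claimCount_iff (h : RegularPath τ σ ω) (t : ℝ) (k : ℕ) :
    k < claimCount τ t ω ↔ arrivalTime τ (k + 1) ω ≤ t := by
  constructor
  · intro hk
    by_contra hkt
    have hsub : {j : ℕ | arrivalTime τ (j + 1) ω ≤ t} ⊆ (Finset.range k : Set ℕ) := by
      intro j hj
      simp only [Finset.coe_range, Set.mem_Iio]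
      by_contra hjk
      exact hkt ((h.monotone_arrivalTime (by omega : k + 1 ≤ j + 1)).trans hj)
    have := Set.ncard_le_ncard hsub (Finset.finite_toSet _)
    rw [Set.ncard_coe_finset, Finset.card_range] at this
    exact absurd hk (not_lt.2 this)
  · intro hk
    have hsub : (Finset.range (k + 1) : Set ℕ) ⊆ {j : ℕ | arrivalTime τ (j + 1) ω ≤ t} := by
      intro j hj
      simp only [Finset.coe_range, Set.mem_Iio] at hj
      exact (h.monotone_arrivalTime (by omega : j + 1 ≤ k + 1)).trans hk
    have := Set.ncard_le_ncard hsub (h.finite t)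
    rwa [Set.ncard_coe_finset, Finset.card_range] at this

lemma claimCount_mono (h : RegularPath τ σ ω) {s t : ℝ} (hst : s ≤ t) :
    claimCount τ s ω ≤ claimCount τ t ω :=
  le_of_forall_lt fun k hk =>
    (h.lt_claimCount_iff t k).2 (((h.lt_claimCount_iff s k).1 hk).trans hst)

lemma discountedClaims_mono (h : RegularPath τ σ ω) (r : ℝ) {s t : ℝ} (hst : s ≤ t) :
    discountedClaims r τ σ s ω ≤ discountedClaims r τ σ t ω :=
  Finset.sum_le_sum_of_subset_of_nonneg
    (Finset.range_subset_range.2 (h.claimCount_mono hst))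
    fun k _ _ => mul_nonneg (Real.exp_pos _).le (h.claim_nonneg k)

/-- The claim counting process is right-continuous. -/
lemma eventually_claimCount_eq (h : RegularPath τ σ ω) (T : ℝ) :
    ∀ᶠ t in 𝓝[>] T, claimCount τ t ω = claimCount τ T ω := by
  -- Only finitely many arrivals occur by `T + 1`, so those after `T` stay away from it.
  have h1 : ∀ᶠ t in 𝓝[>] T, ∀ k ∈ {k : ℕ | arrivalTime τ (k + 1) ω ≤ T + 1},
      arrivalTime τ (k + 1) ω ≤ t → arrivalTime τ (k + 1) ω ≤ T := by
    rw [(h.finite (T + 1)).eventually_all]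
    intro k _
    by_cases hk : arrivalTime τ (k + 1) ω ≤ T
    · exact Eventually.of_forall fun _ _ => hk
    · filter_upwards [nhdsWithin_le_nhds (gt_mem_nhds (not_le.1 hk))] with t ht htk
      exact absurd htk (not_le.2 ht)
  filter_upwards [h1, nhdsWithin_le_nhds (gt_mem_nhds (lt_add_one T)),
    eventually_mem_nhdsWithin] with t ht htT hTt
  refine le_antisymm (le_of_forall_lt fun k hk => ?_) (h.claimCount_mono (le_of_lt hTt))
  have hkt := (h.lt_claimCount_iff t k).1 hk
  exact (h.lt_claimCount_iff T k).2 (ht k (hkt.trans (le_of_lt htT)) hkt)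

lemma discountedClaim_nonneg (h : RegularPath τ σ ω) (r t : ℝ) (k : ℕ) :
    0 ≤ discountedClaim r τ σ t k ω := by
  rw [discountedClaim]
  split_ifs
  · exact mul_nonneg (Real.exp_pos _).le (h.claim_nonneg k)
  · exact le_rfl

lemma exp_mul_claim_le (h : RegularPath τ σ ω) {r : ℝ} (hr : 0 ≤ r) (k : ℕ) :
    Real.exp (-(r * arrivalTime τ (k + 1) ω)) * σ k ω ≤ σ k ω :=
  mul_le_of_le_one_left (h.claim_nonneg k) (Real.exp_le_one_iff.2 (neg_nonpos.2
    (mul_nonneg hr (h.arrivalTime_nonneg _))))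

lemma discountedClaim_le (h : RegularPath τ σ ω) {r : ℝ} (hr : 0 ≤ r) (t : ℝ) (k : ℕ) :
    discountedClaim r τ σ t k ω ≤ σ k ω := by
  rw [discountedClaim]
  split_ifs
  · exact h.exp_mul_claim_le hr k
  · exact h.claim_nonneg k

lemma discountedClaims_eq_sum (h : RegularPath τ σ ω) (r t : ℝ) {n : ℕ}
    (hn : claimCount τ t ω ≤ n) :
    discountedClaims r τ σ t ω = ∑ k ∈ Finset.range n, discountedClaim r τ σ t k ω := by
  rw [discountedClaims]
  rw [← Finset.sum_subset (Finset.range_subset_range.2 hn)]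
  · refine Finset.sum_congr rfl fun k hk => ?_
    rw [discountedClaim, if_pos ((h.lt_claimCount_iff t k).1 (Finset.mem_range.1 hk))]
  · intro k _ hk
    rw [discountedClaim, if_neg]
    rwa [← h.lt_claimCount_iff t k, ← Finset.mem_range]

lemma discountedClaim_le_discountedClaims (h : RegularPath τ σ ω) (r t : ℝ) (k : ℕ) :
    discountedClaim r τ σ t k ω ≤ discountedClaims r τ σ t ω := by
  rw [h.discountedClaims_eq_sum r t (le_max_left _ (k + 1))]
  exact Finset.single_le_sum (f := fun j => discountedClaim r τ σ t j ω)
    (fun j _ => h.discountedClaim_nonneg r t j)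
    (Finset.mem_range.2 (Nat.lt_of_succ_le (le_max_right _ _)))

/-- Pigeonhole: discounting only shrinks claims, so some undiscounted claim exceeds the average `x /
(j + 1)`. -/
lemma exists_claim_gt (h : RegularPath τ σ ω) {r : ℝ} (hr : 0 ≤ r) {t x : ℝ}
    {j : ℕ} (hj : claimCount τ t ω = j + 1) (hx : x < discountedClaims r τ σ t ω) :
    arrivalTime τ (j + 1) ω ≤ t ∧ ∃ k < j + 1, x / (j + 1 : ℕ) < σ k ω := by
  refine ⟨(h.lt_claimCount_iff t j).1 (by omega), ?_⟩
  by_contra! hcon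
  have : discountedClaims r τ σ t ω ≤ x := by
    rw [discountedClaims, hj]
    calc _ ≤ ∑ k ∈ Finset.range (j + 1), x / (j + 1 : ℕ) :=
          Finset.sum_le_sum fun k hk =>
            (h.exp_mul_claim_le hr k).trans (hcon k (Finset.mem_range.1 hk))
      _ = x := by
          rw [Finset.sum_const, Finset.card_range, nsmul_eq_mul]
          field_simp
  linarith

/-- A large sum has a summand that is nearly as large, or two large summands. -/
lemma exists_large_of_sum_gt (h : RegularPath τ σ ω) {r : ℝ} (hr : 0 ≤ r) {t x b : ℝ}
    (hb : 0 ≤ b) (hb1 : b ≤ 1) (hx : 0 ≤ x) {n : ℕ} (hn : 0 < n)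
    (hsum : x < ∑ k ∈ Finset.range n, discountedClaim r τ σ t k ω) :
    (∃ k ∈ Finset.range n, b * x < discountedClaim r τ σ t k ω) ∨
      ∃ p ∈ (Finset.range n).offDiag,
        (1 - b) / n * x < σ p.1 ω ∧ (1 - b) / n * x < σ p.2 ω := by
  by_contra! hcon
  obtain ⟨h1, h2⟩ := hcon
  have hn' : (0 : ℝ) < n := by exact_mod_cast hn
  have hnx : ∑ _k ∈ Finset.range n, (1 - b) / n * x = (1 - b) * x := by
    rw [Finset.sum_const, Finset.card_range, nsmul_eq_mul]
    field_simp
  have hbx : 0 ≤ b * x := mul_nonneg hb hx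
  by_cases hall : ∀ k ∈ Finset.range n, discountedClaim r τ σ t k ω ≤ (1 - b) / n * x
  · have := Finset.sum_le_sum hall
    rw [hnx] at this
    linarith
  -- One summand exceeds `(1 - b) / n * x`, so all others are at most that. It is itself at most `b
  -- * x`, and the total cannot exceed `x`.
  · push Not at hall
    obtain ⟨k, hk, hkx⟩ := hall
    have hoth : ∀ j ∈ (Finset.range n).erase k,
        discountedClaim r τ σ t j ω ≤ (1 - b) / n * x := by
      intro j hj
      rw [Finset.mem_erase] at hj
      exact (h.discountedClaim_le hr t j).trans (h2 (k, j)
        (Finset.mem_offDiag.2 ⟨hk, hj.2, fun hh => hj.1 hh.symm⟩)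
        (hkx.trans_le (h.discountedClaim_le hr t k)))
    rw [← Finset.add_sum_erase _ _ hk] at hsum hnx
    have h3 := Finset.sum_le_sum hoth
    have h4 := h1 k hk
    have hs : 0 ≤ (1 - b) / n * x :=
      mul_nonneg (div_nonneg (sub_nonneg.2 hb1) hn'.le) hx
    linarith

/-- The infimum need not be attained, so ruin is only known to occur before some `t'` slightly
larger than `T`. Right-continuity of the claim count lets `t'` be chosen with no claim in `(T, t']`;
the bound `t' < T + 1` explains the `T + 1` in the premium term. Negativity of the second line alone
is enough. -/
lemma lt_discountedClaims_of_ruinTimeMax_le (h : RegularPath τ σ ω) {r T : ℝ} (hr : 0 ≤ r)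
    {c₁ c₂ δ₁ δ₂ u₁ x₂ : ℝ} (hδ₂ : 0 < δ₂)
    (hruin : ruinTimeMax r τ σ c₁ c₂ δ₁ δ₂ u₁ (δ₂ * x₂) ω ≤ (T : EReal)) :
    x₂ + -(|c₂| / δ₂ * (T + 1)) < discountedClaims r τ σ T ω := by
  obtain ⟨t', ht', ht'1, hTt'⟩ := ((h.eventually_claimCount_eq T).and
    ((eventually_nhdsWithin_of_eventually_nhds (gt_mem_nhds (lt_add_one T))).and eventually_mem_nhdsWithin)).exists
  replace hTt' : T < t' := hTt'
  replace ht'1 : t' < T + 1 := ht'1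
  obtain ⟨_, ⟨t, ht0, hneg, rfl⟩, htt'⟩ :=
    sInf_lt_iff.1 (hruin.trans_lt (EReal.coe_lt_coe_iff.2 hTt'))
  rw [EReal.coe_lt_coe_iff] at htt'
  have h1 := (surplus_neg_iff r τ σ (δ₂ * x₂) c₂ δ₂ t ω).1 ((le_max_right _ _).trans_lt hneg)
  have h2 : discountedClaims r τ σ t ω ≤ discountedClaims r τ σ T ω := by
    refine (h.discountedClaims_mono r htt'.le).trans (le_of_eq ?_)
    rw [discountedClaims, discountedClaims, ht']
  have h3 := (abs_le.1 (abs_mul_integral_exp_le hr ht0 c₂)).1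
  have h4 : |c₂| * t ≤ |c₂| * (T + 1) :=
    mul_le_mul_of_nonneg_left (by linarith) (abs_nonneg _)
  have h5 := mul_le_mul_of_nonneg_left h2 hδ₂.le
  have h6 : δ₂ * (x₂ + -(|c₂| / δ₂ * (T + 1))) = δ₂ * x₂ - |c₂| * (T + 1) := by
    field_simp
    ring
  refine lt_of_mul_lt_mul_left (a := δ₂) ?_ hδ₂.le
  linarith

end RegularPath

end Paths

end BivariateRisk

namespace BivariateRisk

open scoped ENNReal Nat

/-! ### Probability estimates in the claim model. -/

section Model

variable {Ω : Type*} [MeasurableSpace Ω]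

/-- Independent sequences of i.i.d. exponential waiting times and i.i.d. claims with law `F`. -/
structure ClaimModel (μ : Measure Ω) (lam : ℝ) (F : Measure ℝ) (τ σ : ℕ → Ω → ℝ) : Prop where
  rate_pos : 0 < lam
  ae_nonneg : ∀ᵐ y ∂F, 0 ≤ y
  hasLaw_waiting : ∀ k, HasLaw (τ k) (expMeasure lam) μ
  indep_waiting : iIndepFun τ μ
  hasLaw_claim : ∀ k, HasLaw (σ k) F μ
  indep_claim : iIndepFun σ μ
  indep : IndepFun (fun ω k => τ k ω) (fun ω k => σ k ω) μ

variable {μ : Measure Ω} {lam : ℝ} {F : Measure ℝ} {τ σ : ℕ → Ω → ℝ}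

/-- Bonferroni's inequality with a uniform bound for the pairwise intersections. -/
lemma sum_measureReal_le_biUnion [IsFiniteMeasure μ] {A : ℕ → Set Ω} (hA : ∀ k, NullMeasurableSet (A k) μ) {s : ℝ}
    (hs : ∀ j k, j ≠ k → μ.real (A j ∩ A k) ≤ s) (n : ℕ) :
    ∑ k ∈ Finset.range n, μ.real (A k) ≤
      μ.real (⋃ k ∈ Finset.range n, A k) + n ^ 2 * s := by
  have hs0 : 0 ≤ s := measureReal_nonneg.trans (hs 0 1 (by norm_num))
  induction n with
  | zero => simp
  | succ n ih =>
    have h1 : (⋃ k ∈ Finset.range (n + 1), A k) = (⋃ k ∈ Finset.range n, A k) ∪ A n := by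
      rw [Finset.range_add_one, Finset.set_biUnion_insert, Set.union_comm]
    have h2 := measureReal_union_add_inter₀ (μ := μ) (s := ⋃ k ∈ Finset.range n, A k) (hA n)
      (measure_ne_top _ _) (measure_ne_top _ _)
    have h3 : μ.real ((⋃ k ∈ Finset.range n, A k) ∩ A n) ≤ n * s := by
      rw [Set.iUnion₂_inter]
      calc _ ≤ ∑ k ∈ Finset.range n, μ.real (A k ∩ A n) :=
            measureReal_biUnion_finset_le _ _
        _ ≤ ∑ _k ∈ Finset.range n, s :=
            Finset.sum_le_sum fun k hk => hs k n (Finset.mem_range.1 hk).ne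
        _ = n * s := by simp
    rw [Finset.sum_range_succ, h1]
    push_cast
    nlinarith [mul_nonneg (Nat.cast_nonneg (α := ℝ) n) hs0]

namespace ClaimModel

lemma hasLaw_arrival (h : ClaimModel μ lam F τ σ) (k : ℕ) :
    HasLaw (arrivalTime τ (k + 1)) (gammaMeasure (k + 1 : ℝ) lam) μ :=
  hasLaw_arrivalTime h.rate_pos h.hasLaw_waiting h.indep_waiting k

lemma indepFun_arrival_claim (h : ClaimModel μ lam F τ σ) (k : ℕ) : IndepFun (arrivalTime τ (k + 1)) (σ k) μ := by
  have h1 : Measurable fun w : ℕ → ℝ => ∑ i ∈ Finset.range (k + 1), w i := by fun_prop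
  exact h.indep.comp h1 (measurable_pi_apply k)

lemma measureReal_claim_gt (h : ClaimModel μ lam F τ σ) (k : ℕ) (x : ℝ) : μ.real {ω | x < σ k ω} = tail F x :=
  (h.hasLaw_claim k).measureReal_eq (p := fun y => x < y) measurableSet_Ioi

lemma measure_arrival_le (h : ClaimModel μ lam F τ σ) (k : ℕ) {t : ℝ} (ht : 0 < t) :
    μ {ω | arrivalTime τ (k + 1) ω ≤ t} ≤ ENNReal.ofReal ((lam * t) ^ (k + 1) / k !) := by
  rw [(h.hasLaw_arrival k).measure_eq (p := fun y => y ≤ t) measurableSet_Iic]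
  exact gammaMeasure_Iic_le k h.rate_pos ht

lemma measureReal_two_claims_gt (h : ClaimModel μ lam F τ σ) {j k : ℕ} (hjk : j ≠ k) (x : ℝ) :
    μ.real {ω | x < σ j ω ∧ x < σ k ω} = tail F x ^ 2 := by
  have := (h.indep_claim.indepFun hjk).measure_inter_preimage_eq_mul (Set.Ioi x) (Set.Ioi x)
    measurableSet_Ioi measurableSet_Ioi
  rw [sq, ← h.measureReal_claim_gt j x]
  nth_rewrite 2 [h.measureReal_claim_gt j x]
  rw [← h.measureReal_claim_gt k x, measureReal_def, measureReal_def, measureReal_def,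
    ← ENNReal.toReal_mul]
  exact congrArg _ this

lemma nullMeasurableSet_discountedClaim_gt (h : ClaimModel μ lam F τ σ) (r t x : ℝ) (k : ℕ) :
    NullMeasurableSet {ω | x < discountedClaim r τ σ t k ω} μ := by
  have h1 := (h.hasLaw_arrival k).aemeasurable
  have h2 := (h.hasLaw_claim k).aemeasurable
  have h3 : Measurable fun p : ℝ × ℝ => if p.1 ≤ t then Real.exp (-(r * p.1)) * p.2 else 0 :=
    Measurable.ite (measurableSet_Iic.preimage measurable_fst) (by fun_prop) measurable_const
  have h4 : AEMeasurable (discountedClaim r τ σ t k) μ := h3.comp_aemeasurable (h1.prodMk h2)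
  exact h4.nullMeasurableSet_preimage measurableSet_Ioi

lemma ae_regularPath (h : ClaimModel μ lam F τ σ) : ∀ᵐ ω ∂μ, RegularPath τ σ ω := by
  have h1 : ∀ᵐ ω ∂μ, ∀ k, 0 ≤ τ k ω := ae_all_iff.2 fun k =>
    ((h.hasLaw_waiting k).ae_iff (p := fun y => 0 ≤ y) (measurableSet_Ici.mem)).2
      (gammaMeasure_ae_nonneg 1 lam)
  have h2 : ∀ᵐ ω ∂μ, ∀ k, 0 ≤ σ k ω := ae_all_iff.2 fun k =>
    ((h.hasLaw_claim k).ae_iff (p := fun y => 0 ≤ y) (measurableSet_Ici.mem)).2 h.ae_nonneg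
  -- Borel–Cantelli at the countably many positive times `m + 1`; every `t` lies below one of them.
  have h3 : ∀ᵐ ω ∂μ, ∀ m : ℕ, {k : ℕ | arrivalTime τ (k + 1) ω ≤ (m + 1 : ℝ)}.Finite := by
    refine ae_all_iff.2 fun m => ?_
    refine ae_finite_setOfPred_mem (s := fun k => {ω | arrivalTime τ (k + 1) ω ≤ (m + 1 : ℝ)}) ?_
    have hm : (0 : ℝ) < m + 1 := by positivity
    have hsum : Summable fun k : ℕ => (lam * (m + 1)) ^ (k + 1) / (k ! : ℝ) := by
      have := (Real.summable_pow_div_factorial (lam * (m + 1))).mul_left (lam * (m + 1))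
      refine this.congr fun k => ?_
      rw [pow_succ]; ring
    refine ne_top_of_le_ne_top ?_ (ENNReal.tsum_le_tsum fun k => h.measure_arrival_le k hm)
    exact hsum.tsum_ofReal_ne_top
  filter_upwards [h1, h2, h3] with ω hω1 hω2 hω3
  refine ⟨hω1, hω2, fun t => ?_⟩
  obtain ⟨m, hm⟩ := exists_nat_ge t
  exact (hω3 m).subset fun k hk => le_trans hk (hm.trans (by linarith))

variable [IsProbabilityMeasure μ]

/-- The event of `j + 1` claims, one of which is at least average for the total to exceed `x`. -/
lemma measure_arrival_inter_claim_le (h : ClaimModel μ lam F τ σ) (j : ℕ) {t : ℝ} (ht : 0 < t) (y : ℝ) :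
    μ {ω | arrivalTime τ (j + 1) ω ≤ t ∧ ∃ k < j + 1, y < σ k ω} ≤
      ENNReal.ofReal ((lam * t) ^ (j + 1) / j ! * ((j + 1 : ℕ) * tail F y)) := by
  have h1 : Measurable fun w : ℕ → ℝ => ∑ i ∈ Finset.range (j + 1), w i := by fun_prop
  have h2 : MeasurableSet {w : ℕ → ℝ | ∃ k < j + 1, y < w k} := by
    have : {w : ℕ → ℝ | ∃ k < j + 1, y < w k} =
        ⋃ k ∈ Finset.range (j + 1), {w : ℕ → ℝ | y < w k} := by
      ext w; simp
    rw [this]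
    exact Finset.measurableSet_biUnion _ fun k _ =>
      measurableSet_lt measurable_const (measurable_pi_apply k)
  have h3 := h.indep.measure_inter_preimage_eq_mul _ _ (h1 (measurableSet_Iic (a := t))) h2
  have h4 : μ {ω | ∃ k < j + 1, y < σ k ω} ≤ ENNReal.ofReal ((j + 1 : ℕ) * tail F y) := by
    have : {ω | ∃ k < j + 1, y < σ k ω} = ⋃ k ∈ Finset.range (j + 1), {ω | y < σ k ω} := by
      ext ω; simp
    rw [this, ← ofReal_measureReal (measure_ne_top _ _)]
    refine ENNReal.ofReal_le_ofReal ((measureReal_biUnion_finset_le _ _).trans ?_)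
    simp [h.measureReal_claim_gt]
  have hl := h.rate_pos
  calc _ = μ {ω | arrivalTime τ (j + 1) ω ≤ t} * μ {ω | ∃ k < j + 1, y < σ k ω} := h3
    _ ≤ _ := by
      rw [ENNReal.ofReal_mul (by positivity)]
      exact mul_le_mul' (h.measure_arrival_le j ht) h4

/-- The law of the discounted claims is bounded below by the union of single large claims. -/
lemma sum_le_measureReal_discountedClaims (h : ClaimModel μ lam F τ σ) {r : ℝ} (hr : 0 ≤ r) (t x : ℝ) (n : ℕ) :
    ∑ k ∈ Finset.range n, μ.real {ω | x < discountedClaim r τ σ t k ω} - n ^ 2 * tail F x ^ 2 ≤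
      μ.real {ω | x < discountedClaims r τ σ t ω} := by
  have h1 := sum_measureReal_le_biUnion (μ := μ) (s := tail F x ^ 2)
    (h.nullMeasurableSet_discountedClaim_gt r t x) (fun j k hjk => by
      rw [← h.measureReal_two_claims_gt hjk x]
      refine ENNReal.toReal_mono (measure_ne_top _ _) (measure_mono_ae ?_)
      filter_upwards [h.ae_regularPath] with ω hω hm
      exact ⟨lt_of_lt_of_le hm.1 (hω.discountedClaim_le hr t j),
        lt_of_lt_of_le hm.2 (hω.discountedClaim_le hr t k)⟩) n
  have h2 : μ.real (⋃ k ∈ Finset.range n, {ω | x < discountedClaim r τ σ t k ω}) ≤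
      μ.real {ω | x < discountedClaims r τ σ t ω} := by
    refine ENNReal.toReal_mono (measure_ne_top _ _) (measure_mono_ae ?_)
    filter_upwards [h.ae_regularPath] with ω hω hm
    obtain ⟨k, _, hk⟩ := Set.mem_iUnion₂.1 hm
    exact lt_of_lt_of_le hk (hω.discountedClaim_le_discountedClaims r t k)
  linarith

/-- The discounted claims exceed `x` because of one large claim among the first `n`, of two
moderately large ones, or of more than `n` arrivals. -/
lemma measureReal_discountedClaims_le (h : ClaimModel μ lam F τ σ) {r : ℝ} (hr : 0 ≤ r) (t : ℝ) {x b : ℝ}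
    (hb : 0 ≤ b) (hb1 : b ≤ 1) (hx : 0 ≤ x) {n : ℕ} (hn : 0 < n) :
    μ.real {ω | x < discountedClaims r τ σ t ω} ≤
      ∑ k ∈ Finset.range n, μ.real {ω | b * x < discountedClaim r τ σ t k ω} +
        n ^ 2 * tail F ((1 - b) / n * x) ^ 2 +
        μ.real (⋃ j : ℕ, {ω | arrivalTime τ (j + n + 1) ω ≤ t ∧
          ∃ k < j + n + 1, x / (j + n + 1 : ℕ) < σ k ω}) := by
  set A₁ : Set Ω := ⋃ k ∈ Finset.range n, {ω | b * x < discountedClaim r τ σ t k ω}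
  set A₂ : Set Ω := ⋃ p ∈ (Finset.range n).offDiag,
    {ω | (1 - b) / n * x < σ p.1 ω ∧ (1 - b) / n * x < σ p.2 ω}
  set A₃ : Set Ω := ⋃ j : ℕ, {ω | arrivalTime τ (j + n + 1) ω ≤ t ∧
          ∃ k < j + n + 1, x / (j + n + 1 : ℕ) < σ k ω}
  have h1 : μ.real A₁ ≤ ∑ k ∈ Finset.range n, μ.real {ω | b * x < discountedClaim r τ σ t k ω} :=
    measureReal_biUnion_finset_le _ _
  have h2 : μ.real A₂ ≤ n ^ 2 * tail F ((1 - b) / n * x) ^ 2 := by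
    refine (measureReal_biUnion_finset_le _ _).trans ?_
    rw [Finset.sum_congr rfl fun p hp =>
      h.measureReal_two_claims_gt (Finset.mem_offDiag.1 hp).2.2 ((1 - b) / n * x)]
    rw [Finset.sum_const, nsmul_eq_mul, Finset.offDiag_card, Finset.card_range]
    refine mul_le_mul_of_nonneg_right ?_ (sq_nonneg _)
    rw [sq]
    exact_mod_cast Nat.sub_le _ _
  have h3 : μ.real {ω | x < discountedClaims r τ σ t ω} ≤ μ.real (A₁ ∪ A₂ ∪ A₃) := by
    refine ENNReal.toReal_mono (measure_ne_top _ _) (measure_mono_ae ?_)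
    filter_upwards [h.ae_regularPath] with ω hω hm
    change x < discountedClaims r τ σ t ω at hm
    change ω ∈ A₁ ∪ A₂ ∪ A₃
    by_cases hN : claimCount τ t ω ≤ n
    · left
      rw [hω.discountedClaims_eq_sum r t hN] at hm
      rcases hω.exists_large_of_sum_gt hr hb hb1 hx hn hm with ⟨k, hk, hkx⟩ | ⟨p, hp, hpx⟩
      · exact Or.inl (Set.mem_iUnion₂.2 ⟨k, hk, hkx⟩)
      · exact Or.inr (Set.mem_iUnion₂.2 ⟨p, hp, hpx⟩)
    · right
      -- The index `j` in `A₃` records that there are exactly `j + n + 1` claims.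
      obtain ⟨j, hj⟩ := Nat.exists_eq_add_of_lt (not_le.1 hN)
      exact Set.mem_iUnion.2 ⟨j, hω.exists_claim_gt hr (by omega) hm⟩
  have h4 := measureReal_union_le (μ := μ) (A₁ ∪ A₂) A₃
  have h5 := measureReal_union_le (μ := μ) A₁ A₂
  linarith

/-- The distribution of a single discounted claim. -/
lemma measureReal_discountedClaim_gt [IsProbabilityMeasure F] (h : ClaimModel μ lam F τ σ) (r t : ℝ) {x : ℝ} (hx : 0 ≤ x) (k : ℕ) :
    μ.real {ω | x < discountedClaim r τ σ t k ω} =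
      ∫ v, tail F (Real.exp (r * v) * x)
        ∂((gammaMeasure (k + 1 : ℝ) lam).restrict (Set.Iic t)) := by
  have := isProbabilityMeasure_gammaMeasure (a := k + 1) (by positivity) h.rate_pos
  have h1 := (h.hasLaw_arrival k).aemeasurable
  have h2 := (h.hasLaw_claim k).aemeasurable
  have hlaw := (h.indepFun_arrival_claim k).map_prod_eq_prod_map_map h1 h2
  rw [(h.hasLaw_arrival k).map_eq, (h.hasLaw_claim k).map_eq] at hlaw
  set B : Set (ℝ × ℝ) := {p | p.1 ≤ t ∧ Real.exp (r * p.1) * x < p.2} with hB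
  have hBm : MeasurableSet B :=
    (measurableSet_le measurable_fst measurable_const).inter
      (measurableSet_lt (by fun_prop) measurable_snd)
  have hset : {ω | x < discountedClaim r τ σ t k ω} =
      (fun ω => (arrivalTime τ (k + 1) ω, σ k ω)) ⁻¹' B := by
    ext ω
    simp only [Set.mem_ofPred_eq, Set.mem_preimage, hB, discountedClaim]
    by_cases hω : arrivalTime τ (k + 1) ω ≤ t
    · rw [if_pos hω, Real.exp_neg, inv_mul_eq_div, lt_div_iff₀' (Real.exp_pos _)]
      simp [hω]
    -- A claim that has not arrived counts as 0, which does not exceed `x ≥ 0`.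
    · simp [hω, hx]
  rw [hset, measureReal_def, ← Measure.map_apply_of_aemeasurable (h1.prodMk h2) hBm, hlaw,
    Measure.prod_apply hBm, integral_eq_lintegral_of_nonneg_ae
      (ae_of_all _ fun v => tail_nonneg _ _)
      (measurable_tail.comp (by fun_prop)).aestronglyMeasurable,
    ← lintegral_indicator measurableSet_Iic]
  congr 1
  refine lintegral_congr fun v => ?_
  by_cases hv : v ≤ t
  · rw [Set.indicator_of_mem (Set.mem_Iic.2 hv), tail, ofReal_measureReal]
    congr 1
    ext y
    simp [hB, hv]
  · rw [Set.indicator_of_notMem (by simpa using hv)]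
    have : Prod.mk v ⁻¹' B = ∅ := by
      ext y
      simp [hB, hv]
    rw [this, measure_empty]

end ClaimModel

end Model

end BivariateRisk

namespace BivariateRisk

open scoped ENNReal Nat

/-! ### Tail asymptotics of the discounted claims. -/

section Asymptotics

/-- The limiting constants of the single claims add up to that of the aggregate, because the renewal
measure is `λ dv` on `(0, t]`. -/
lemma hasSum_discountFactor {lam : ℝ} (hlam : 0 < lam) (α r t : ℝ) :
    HasSum (fun k : ℕ => ∫ v, Real.exp (r * v) ^ (-α)
        ∂((gammaMeasure (k + 1 : ℝ) lam).restrict (Set.Iic t)))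
      (lam * ∫ v in Set.Ioc 0 t, Real.exp (r * v) ^ (-α)) := by
  have hc : Continuous fun v : ℝ => Real.exp (r * v) ^ (-α) :=
    Continuous.rpow_const (by fun_prop) fun v => Or.inl (Real.exp_pos _).ne'
  have hs := hasSum_integral_measure (f := fun v : ℝ => Real.exp (r * v) ^ (-α))
    (μ := fun k : ℕ => (gammaMeasure (k + 1 : ℝ) lam).restrict (Set.Iic t)) (by
      rw [sum_gammaMeasure_restrict hlam]
      exact (hc.integrableOn_Ioc).smul_measure ENNReal.ofReal_ne_top)
  rwa [sum_gammaMeasure_restrict hlam, integral_smul_measure, ENNReal.toReal_ofReal hlam.le,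
    smul_eq_mul] at hs

variable {Ω : Type*} [MeasurableSpace Ω] {μ : Measure Ω} [IsProbabilityMeasure μ] {lam : ℝ}
  {F : Measure ℝ} [IsProbabilityMeasure F] {τ σ : ℕ → Ω → ℝ} {α r t : ℝ}

namespace ClaimModel

/-- Many arrivals contribute little to large discounted claims, uniformly in the level. -/
lemma exists_summable_many_arrivals (h : ClaimModel μ lam F τ σ) (hF : RegularTail F α)
    (ht : 0 < t) :
    ∃ (β : ℕ → ℝ) (x₀ : ℝ), Summable β ∧ ∀ (n : ℕ) (x : ℝ), x₀ ≤ x →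
      μ.real (⋃ j : ℕ, {ω | arrivalTime τ (j + n + 1) ω ≤ t ∧
          ∃ k < j + n + 1, x / (j + n + 1 : ℕ) < σ k ω}) ≤ (∑' j, β (j + n)) * tail F x := by
  obtain ⟨C, K, x₀, hC, hK, hb⟩ := hF.exists_div_natCast_le
  have hl := h.rate_pos
  -- The three factors bound the probability of `j + 1` arrivals, count the candidates for the large
  -- claim, and compare the level `x / (j + 1)` with `x`.
  set β : ℕ → ℝ := fun j => (lam * t) ^ (j + 1) / j ! * ((j + 1 : ℕ) * (C * K ^ (j + 1))) with hβ
  have hβ0 : ∀ j, 0 ≤ β j := fun j => by positivity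
  have hβs : Summable β := by
    have h1 := (Real.summable_pow_div_factorial (2 * (lam * t * K))).mul_left (C * (lam * t * K))
    refine Summable.of_nonneg_of_le hβ0 (fun j => ?_) h1
    have h2 : ((j + 1 : ℕ) : ℝ) ≤ 2 ^ j := by exact_mod_cast Nat.lt_two_pow_self
    calc β j = (lam * t) ^ (j + 1) / j ! * (C * K ^ (j + 1)) * (j + 1 : ℕ) := by
          simp only [hβ]; ring
      _ ≤ (lam * t) ^ (j + 1) / j ! * (C * K ^ (j + 1)) * 2 ^ j := by gcongr
      _ = C * (lam * t * K) * ((2 * (lam * t * K)) ^ j / j !) := by ring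
  refine ⟨β, x₀, hβs, fun n x hx => ?_⟩
  have hs : Summable fun j => β (j + n) * tail F x :=
    ((summable_nat_add_iff n).2 hβs).mul_right _
  have h0 : ∀ j, 0 ≤ β (j + n) * tail F x := fun j => mul_nonneg (hβ0 _) (tail_nonneg F x)
  rw [← tsum_mul_right]
  refine ENNReal.toReal_le_of_le_ofReal (tsum_nonneg h0) ?_
  rw [ENNReal.ofReal_tsum_of_nonneg h0 hs]
  refine (measure_iUnion_le _).trans (ENNReal.tsum_le_tsum fun j => ?_)
  refine (h.measure_arrival_inter_claim_le (j + n) ht _).trans (ENNReal.ofReal_le_ofReal ?_)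
  have h3 := hb (j + n + 1) x (by omega) hx
  calc _ ≤ (lam * t) ^ (j + n + 1) / (j + n)! *
        ((j + n + 1 : ℕ) * (C * K ^ (j + n + 1) * tail F x)) := by gcongr
    _ = β (j + n) * tail F x := by simp only [hβ]; ring

lemma tendsto_discountedClaim_ratio (h : ClaimModel μ lam F τ σ) (hF : RegularTail F α)
    (hr : 0 ≤ r) (t : ℝ) (k : ℕ) :
    Tendsto (fun x => μ.real {ω | x < discountedClaim r τ σ t k ω} / tail F x) atTop
      (𝓝 (∫ v, Real.exp (r * v) ^ (-α)
        ∂((gammaMeasure (k + 1 : ℝ) lam).restrict (Set.Iic t)))) := by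
  have := isProbabilityMeasure_gammaMeasure (a := k + 1) (by positivity) h.rate_pos
  refine (hF.tendsto_integral_discounted hr
    ((gammaMeasure (k + 1 : ℝ) lam).restrict (Set.Iic t))
    (ae_restrict_of_ae (gammaMeasure_ae_nonneg _ _))).congr' ?_
  filter_upwards [eventually_ge_atTop 0] with x hx
  rw [h.measureReal_discountedClaim_gt r t hx k]

/-- The discounted aggregate claims are tail equivalent to a single claim. -/
lemma tendsto_discountedClaims_ratio (h : ClaimModel μ lam F τ σ) (hF : RegularTail F α)
    (hr : 0 ≤ r) (ht : 0 < t) :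
    Tendsto (fun x => μ.real {ω | x < discountedClaims r τ σ t ω} / tail F x) atTop
      (𝓝 (lam * ∫ v in Set.Ioc 0 t, Real.exp (r * v) ^ (-α))) := by
  set c := lam * ∫ v in Set.Ioc 0 t, Real.exp (r * v) ^ (-α) with hc
  set γ : ℕ → ℝ := fun k => ∫ v, Real.exp (r * v) ^ (-α)
        ∂((gammaMeasure (k + 1 : ℝ) lam).restrict (Set.Iic t)) with hγ
  have hγc : HasSum γ c := hasSum_discountFactor h.rate_pos α r t
  have hγ0 : ∀ k, 0 ≤ γ k := fun k => integral_nonneg fun v => by positivity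
  have hsingle : ∀ n : ℕ, Tendsto (fun x => ∑ k ∈ Finset.range n,
      μ.real {ω | x < discountedClaim r τ σ t k ω} / tail F x) atTop
      (𝓝 (∑ k ∈ Finset.range n, γ k)) := fun n =>
    tendsto_finsetSum _ fun k _ => h.tendsto_discountedClaim_ratio hF hr t k
  refine tendsto_order.2 ⟨fun a ha => ?_, fun a ha => ?_⟩
  -- Lower bound: finitely many claims already give more than `a`, and the Bonferroni correction is
  -- of the order of the squared tail.
  · obtain ⟨n, hn⟩ := (hγc.tendsto_sum_nat.eventually (lt_mem_nhds ha)).exists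
    have h1 := (hsingle n).sub ((hF.tendsto_sq_div one_pos).const_mul ((n : ℝ) ^ 2))
    rw [mul_zero, sub_zero] at h1
    filter_upwards [h1.eventually (lt_mem_nhds hn)] with x hx
    refine hx.trans_le ?_
    rw [← Finset.sum_div, one_mul, ← mul_div_assoc, ← sub_div]
    exact div_le_div_of_nonneg_right (h.sum_le_measureReal_discountedClaims hr t x n)
      (tail_nonneg F x)
  · obtain ⟨β, x₀, hβs, hβ⟩ := h.exists_summable_many_arrivals hF ht
    have hcont : Tendsto (fun b : ℝ => b ^ (-α) * c) (𝓝[<] 1) (𝓝 c) := by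
      have := (Real.continuousAt_rpow_const 1 (-α) (Or.inl one_ne_zero)).tendsto.mul_const c
      rw [Real.one_rpow, one_mul] at this
      exact this.mono_left nhdsWithin_le_nhds
    -- Upper bound: `b < 1` is fixed first, so that lowering the level to `b * x` keeps the constant
    -- below `a`; then `n` is taken so large that the many-arrivals remainder fits into the gap.
    obtain ⟨b, hba, hb1, hb0⟩ := ((hcont.eventually (gt_mem_nhds ha)).and
      ((eventually_mem_nhdsWithin (a := (1 : ℝ)) (s := Set.Iio 1)).and
      (eventually_nhdsWithin_of_eventually_nhds (lt_mem_nhds zero_lt_one)))).exists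
    replace hb1 : b < 1 := hb1
    have hR := (tendsto_sum_nat_add β).const_add (b ^ (-α) * c)
    rw [add_zero] at hR
    obtain ⟨n, hna, hn⟩ := ((hR.eventually (gt_mem_nhds hba)).and (eventually_gt_atTop 0)).exists
    have hn' : (0 : ℝ) < n := by exact_mod_cast hn
    have h1 := (((hsingle n).comp (tendsto_id.const_mul_atTop hb0)).mul
      (hF.ratio b hb0)).add
      ((hF.tendsto_sq_div (div_pos (sub_pos.2 hb1) hn')).const_mul ((n : ℝ) ^ 2))
    have h2 := h1.add_const (∑' j, β (j + n))
    have hlim : (∑ k ∈ Finset.range n, γ k) * b ^ (-α) + (n : ℝ) ^ 2 * 0 + ∑' j, β (j + n)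
        < a := by
      have h3 : ∑ k ∈ Finset.range n, γ k ≤ c := sum_le_hasSum _ (fun k _ => hγ0 k) hγc
      have h4 := mul_le_mul_of_nonneg_right h3 (Real.rpow_nonneg hb0.le (-α))
      linarith
    filter_upwards [h2.eventually (gt_mem_nhds hlim), eventually_ge_atTop 0,
      eventually_ge_atTop x₀] with x hx hx0 hxx₀
    refine lt_of_le_of_lt ?_ hx
    have h5 := (h.measureReal_discountedClaims_le hr t hb0.le hb1.le hx0 hn).trans
      (add_le_add_right (hβ n x hxx₀) _)
    refine (div_le_div_of_nonneg_right h5 (tail_nonneg F x)).trans (le_of_eq ?_)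
    have h6 := (hF.pos x).ne'
    have h7 := (hF.pos (b * x)).ne'
    simp only [Function.comp, id, ← Finset.sum_div]
    field_simp

/-- The discounted claims at a shifted level. -/
lemma tendsto_discountedClaims_shift_ratio (h : ClaimModel μ lam F τ σ) (hF : RegularTail F α)
    (hr : 0 ≤ r) (ht : 0 < t) (C : ℝ) :
    Tendsto (fun x => μ.real {ω | x + C < discountedClaims r τ σ t ω} / tail F x) atTop
      (𝓝 (lam * ∫ v in Set.Ioc 0 t, Real.exp (r * v) ^ (-α))) := by
  have h1 := ((h.tendsto_discountedClaims_ratio hF hr ht).comp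
    (tendsto_atTop_add_const_right _ C tendsto_id)).mul (hF.tendsto_shift C)
  rw [mul_one] at h1
  refine h1.congr fun x => ?_
  have := (hF.pos (x + C)).ne'
  simp only [Function.comp, id]
  field_simp

end ClaimModel

end Asymptotics

end BivariateRisk

/-! ### The asymptotics of the ruin probability. -/

open BivariateRisk in
/-- The inter-arrival times `τ k` are i.i.d. exponential with parameter `lam`, the claim sizes `σ k`
are i.i.d. with law `F`, and the two sequences are independent. -/
theorem theorem3p1 {Ω : Type*} [MeasurableSpace Ω] (μ : Measure Ω) [IsProbabilityMeasure μ]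
    (r : ℝ) (hr : 0 ≤ r)
    (c₁ c₂ δ₁ δ₂ : ℝ) (hδ₁ : 0 < δ₁) (hδ₂ : 0 < δ₂) (hδ : δ₁ + δ₂ = 1)
    (hc : c₂ / δ₂ < c₁ / δ₁)
    (lam : ℝ) (hlam : 0 < lam)
    (F : Measure ℝ) [IsProbabilityMeasure F] (hF : ∀ᵐ y ∂F, 0 ≤ y)
    (τ σ : ℕ → Ω → ℝ)
    (hτ : ∀ k, HasLaw (τ k) (expMeasure lam) μ) (hτi : iIndepFun τ μ)
    (hσ : ∀ k, HasLaw (σ k) F μ) (hσi : iIndepFun σ μ)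
    (hτσ : IndepFun (fun ω k => τ k ω) (fun ω k => σ k ω) μ)
    (α : ℝ) (hα : 0 < α) (L : ℝ → ℝ)
    (hLc : ContinuousOn L (Set.Ioi 0)) (hLs : BivariateRisk.SlowlyVarying L)
    (hLt : Tendsto L atTop atTop)
    (htail : ∀ x : ℝ, 0 < x → BivariateRisk.tail F x = L x / x ^ α)
    (T : ℝ) (hT : 0 < T) :
    Tendsto
      (fun x : ℝ × ℝ =>
        BivariateRisk.ruinProbMax μ r τ σ c₁ c₂ δ₁ δ₂ x.1 x.2 T /
          (lam * T * BivariateRisk.tail (BivariateRisk.discountedClaimLaw F r T) x.2))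
      (atTop ⊓ 𝓟 {x : ℝ × ℝ | x.1 ≤ x.2}) (𝓝 1) := by
  have h : ClaimModel μ lam F τ σ := ⟨hlam, hF, hτ, hτi, hσ, hσi, hτσ⟩
  have hreg : RegularTail F α := ⟨tail_pos_of_eq_div hLt htail,
    fun _ => tendsto_tail_ratio_of_slowlyVarying hLs htail⟩
  set c := lam * ∫ v in Set.Ioc 0 T, Real.exp (r * v) ^ (-α) with hcdef
  have hc0 : 0 < c := by
    refine mul_pos hlam ?_
    rw [← intervalIntegral.integral_of_le hT.le]
    refine intervalIntegral.intervalIntegral_pos_of_pos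
      (Continuous.intervalIntegrable (Continuous.rpow_const (by fun_prop)
        fun v => Or.inl (Real.exp_pos _).ne') _ _)
      (fun v => Real.rpow_pos_of_pos (Real.exp_pos _) _) hT
  have hsnd : Tendsto (fun x : ℝ × ℝ => x.2) (atTop ⊓ 𝓟 {x : ℝ × ℝ | x.1 ≤ x.2}) atTop := by
    rw [← prod_atTop_atTop_eq]
    exact tendsto_snd.mono_left inf_le_left
  -- Numerator and denominator are both compared with `tail F x₂` and share the positive limit `c`.
  have hden : Tendsto (fun x => lam * T * tail (discountedClaimLaw F r T) x / tail F x) atTop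
      (𝓝 c) := by
    refine ((hreg.tendsto_integral_discounted hr (volume.restrict (Set.Ioc 0 T))
      ((ae_restrict_iff' measurableSet_Ioc).2
        (ae_of_all _ fun v hv => hv.1.le))).const_mul lam).congr fun x => ?_
    rw [mul_assoc lam T, mul_tail_discountedClaimLaw r hT, mul_div_assoc]
  have hnum : Tendsto (fun x : ℝ × ℝ => ruinProbMax μ r τ σ c₁ c₂ δ₁ δ₂ x.1 x.2 T / tail F x.2)
      (atTop ⊓ 𝓟 {x : ℝ × ℝ | x.1 ≤ x.2}) (𝓝 c) := by
    refine tendsto_of_tendsto_of_tendsto_of_le_of_le'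
      ((h.tendsto_discountedClaims_shift_ratio hreg hr hT
        ((|c₁| / δ₁ + |c₂| / δ₂) * T)).comp hsnd)
      ((h.tendsto_discountedClaims_shift_ratio hreg hr hT (-(|c₂| / δ₂ * (T + 1)))).comp hsnd)
      ?_ ?_
    -- The ordering `x₁ ≤ x₂` enters here: a large `D(T)` must ruin both lines.
    · filter_upwards [mem_inf_of_right (mem_principal_self _)] with x hx
      refine div_le_div_of_nonneg_right (measureReal_mono fun ω hω => ?_) (tail_nonneg F _)
      exact ruinTimeMax_le hr hT.le hδ₁ hδ₂ hx hω
    · refine Eventually.of_forall fun x => div_le_div_of_nonneg_right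
        (ENNReal.toReal_mono (measure_ne_top _ _) (measure_mono_ae ?_)) (tail_nonneg F _)
      filter_upwards [h.ae_regularPath] with ω hω hruin
      exact hω.lt_discountedClaims_of_ruinTimeMax_le hr hδ₂ hruin
  have hquot := hnum.div (hden.comp hsnd) hc0.ne'
  rw [div_self hc0.ne'] at hquot
  refine hquot.congr fun x => ?_
  exact div_div_div_cancel_right₀ (hreg.pos x.2).ne' _ _
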